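/- Let $G$ be a finite abelian group and let $e$ denote its exponent. A $\mathbb{Z}$-order in $\mathbb{Q}[G]$ is a subring of $\mathbb{Q}[G]$ that is finitely generated as a $\mathbb{Z}$-module and spans $\mathbb{Q}[G]$ over $\mathbb{Q}$; it is maximal if it is not properly contained in any other $\mathbb{Z}$-order in $\mathbb{Q}[G]$. Then $\mathbb{Q}[G]$ has a unique maximal $\mathbb{Z}$-order $\mathcal{M}$, it contains $\mathbb{Z}[G]$, and the group index of $\mathbb{Z}[G]$ in $\mathcal{M}$ is \[ [\mathcal{M} : \mathbb{Z}[G]] = \left( |G|^{|G|} \prod_{d \mid e }\left( d^{-\phi(d)} \prod_{p \mid d } p^{\frac{\phi(d)}{p-1}} \right)^{t_d} \right)^{\frac{1}{2}}, \] where $d$ runs over the positive divisors of $e$, $p$ runs over the prime divisors of $d$, $t_{d}$ denotes the number of cyclic subgroups of $G$ of order $d$, and $\phi$ denotes the Euler totient function. -/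

import Mathlib

/-- A subring `Λ` of a `ℚ`-algebra `A` is a `ℤ`-order in `A` if it is a full `ℤ`-lattice in `A`:
it is finitely generated as a `ℤ`-module and spans `A` over `ℚ`. -/
def IsZOrder {A : Type*} [Ring A] [Algebra ℚ A] (Λ : Subring A) : Prop :=
  Submodule.IsLattice ℚ (AddSubgroup.toIntSubmodule Λ.toAddSubgroup)

/-- A maximal `ℤ`-order: a `ℤ`-order not properly contained in any other `ℤ`-order in `A`. -/
def IsMaximalZOrder {A : Type*} [Ring A] [Algebra ℚ A] (M : Subring A) : Prop :=
  Maximal IsZOrder M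

/-- The integral group ring `ℤ[G]`, as a subring of the rational group algebra `ℚ[G]`. -/
noncomputable def integralGroupRing (G : Type*) [Group G] : Subring (MonoidAlgebra ℚ G) :=
  (MonoidAlgebra.mapRingHom G (Int.castRingHom ℚ)).range

/-- The number of cyclic subgroups of `G` of order `d`. -/
noncomputable def numCyclicSubgroups (G : Type*) [Group G] (d : ℕ) : ℕ :=
  Nat.card {H : Subgroup G // IsCyclic H ∧ Nat.card H = d}

/-! Elements of an order are integral, so the integral closure of `ℤ` is the unique maximal order
once it is a lattice. Galois orbits of complex characters of `G` correspond to cyclic subgroups of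
the dual, hence of `G`; this splits `ℚ[G]` into cyclotomic fields
(`nonempty_algEquiv_pi_cyclotomicField`), and the integral closure is the product of their rings of
integers. The squared index is the quotient of the absolute discriminants (`relIndex_sq_mul_discr`):
`|G| ^ |G|` for `ℤ[G]`, and a product of cyclotomic discriminants for the maximal order. -/

open Module


/-! ### Orders and integral closure -/

section Orders

variable {A : Type*} [CommRing A] [Algebra ℚ A]

/-- Every element of a `ℤ`-order is integral over `ℤ`. -/
theorem IsZOrder.le_integralClosure {Λ : Subring A} (h : IsZOrder Λ) :
    Λ ≤ (integralClosure ℤ A).toSubring := fun _ hx =>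
  IsIntegral.of_mem_of_fg (subalgebraOfSubring Λ) h.fg _ hx

/-- If the integral closure of `ℤ` is an order, it is the only maximal one. -/
theorem isMaximalZOrder_iff_eq_integralClosure
    (h : IsZOrder (integralClosure ℤ A).toSubring) {M : Subring A} :
    IsMaximalZOrder M ↔ M = (integralClosure ℤ A).toSubring := by
  refine ⟨fun hM => hM.eq_of_le h hM.1.le_integralClosure, ?_⟩
  rintro rfl
  exact ⟨h, fun _ hN _ => hN.le_integralClosure⟩

/-- A subring generated as an additive group by a `ℚ`-basis is an order. -/
theorem isZOrder_of_eq_closure_basis {ι : Type*} [Finite ι] (b : Basis ι ℚ A) {Λ : Subring A}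
    (h : Λ.toAddSubgroup = AddSubgroup.closure (Set.range b)) : IsZOrder Λ := by
  have h' : AddSubgroup.toIntSubmodule Λ.toAddSubgroup = Submodule.span ℤ (Set.range b) := by
    rw [h]
    exact (Submodule.span_int_eq_addSubgroupClosure (Set.range b)) ▸ rfl
  unfold IsZOrder
  rw [h']
  refine ⟨Submodule.fg_span (Set.finite_range b), ?_⟩
  rw [Submodule.span_span_of_tower, b.span_eq]

end Orders

/-! ### Discriminants of product algebras -/

/-- The determinant of a block diagonal matrix with blocks of various sizes. -/
theorem Matrix.det_blockDiagonal_sigma {ι R : Type*} [Fintype ι] [DecidableEq ι] [CommRing R]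
    {κ : ι → Type*} [∀ i, Fintype (κ i)] [∀ i, DecidableEq (κ i)]
    (M : ∀ i, Matrix (κ i) (κ i) R) :
    (Matrix.blockDiagonal' M).det = ∏ i, (M i).det := by
  -- Block triangularity needs ordered labels, so `ι` is numbered.
  have hM : (Matrix.blockDiagonal' M).BlockTriangular fun a => Fintype.equivFin ι a.1 := by
    rintro ⟨i, k⟩ ⟨j, l⟩ h
    refine Matrix.blockDiagonal'_apply_ne _ _ _ ?_
    rintro rfl
    exact lt_irrefl _ h
  rw [hM.det_fintype, ← (Fintype.equivFin ι).prod_comp]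
  refine Finset.prod_congr rfl fun i _ => ?_
  let e : κ i ≃ {a : Σ i, κ i // Fintype.equivFin ι a.1 = Fintype.equivFin ι i} :=
    Equiv.ofBijective (fun k => ⟨⟨i, k⟩, rfl⟩) ⟨fun k l h => by simpa using h, by
      rintro ⟨⟨j, l⟩, h⟩
      obtain rfl : j = i := (Fintype.equivFin ι).injective h
      exact ⟨l, rfl⟩⟩
  rw [← Matrix.det_submatrix_equiv_self e]
  congr 1
  ext k l
  exact Matrix.blockDiagonal'_apply_eq M i k l

section Pi

variable {ι : Type*} [Fintype ι] {R : Type*} [CommRing R] {B : ι → Type*}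
  [∀ i, CommRing (B i)] [∀ i, Algebra R (B i)]

theorem isIntegral_pi_iff {x : ∀ i, B i} : IsIntegral R x ↔ ∀ i, IsIntegral R (x i) := by
  refine ⟨fun h i => h.map (Pi.evalAlgHom R B i), fun h => ?_⟩
  choose p hp hpx using h
  -- Each coordinate is killed by its own factor of the product.
  refine ⟨∏ i, p i, Polynomial.monic_prod_of_monic _ _ fun i _ => hp i, ?_⟩
  ext i
  change Pi.evalAlgHom R B i (Polynomial.aeval x _) = 0
  rw [← Polynomial.aeval_algHom_apply, map_prod]
  exact Finset.prod_eq_zero (Finset.mem_univ i) (hpx i)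

variable [DecidableEq ι] {κ : ι → Type*} [∀ i, Fintype (κ i)] [∀ i, DecidableEq (κ i)]

theorem Algebra.trace_pi_apply (b : ∀ i, Basis (κ i) R (B i)) (x : ∀ i, B i) :
    Algebra.trace R (∀ i, B i) x = ∑ i, Algebra.trace R (B i) (x i) := by
  rw [Algebra.trace_eq_matrix_trace (Pi.basis b)]
  simp_rw [fun i => Algebra.trace_eq_matrix_trace (b i), Matrix.trace, Fintype.sum_sigma]
  refine Finset.sum_congr rfl fun i _ => Finset.sum_congr rfl fun k _ => ?_
  simp [Algebra.leftMulMatrix_eq_repr_mul]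

/-- Distinct factors multiply to zero, so they are orthogonal for the trace form and its Gram matrix
is block diagonal. -/
theorem Algebra.discr_pi_basis (b : ∀ i, Basis (κ i) R (B i)) :
    Algebra.discr R (Pi.basis b) = ∏ i, Algebra.discr R (b i) := by
  simp_rw [Algebra.discr_def]
  rw [← Matrix.det_blockDiagonal_sigma]
  congr 1
  ext ⟨i, k⟩ ⟨j, l⟩
  rw [Algebra.traceMatrix_apply, Algebra.traceForm_apply, Algebra.trace_pi_apply b]
  by_cases hij : i = j
  · subst hij
    rw [Matrix.blockDiagonal'_apply_eq, Finset.sum_eq_single i]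
    · simp [Algebra.traceMatrix_apply]
    · intro a _ ha
      simp [Pi.basis_apply, ha]
    · simp
  · rw [Matrix.blockDiagonal'_apply_ne _ _ _ hij]
    refine Finset.sum_eq_zero fun a _ => ?_
    by_cases ha : a = i
    · subst ha
      simp [Pi.basis_apply, hij]
    · simp [Pi.basis_apply, ha]

end Pi

/-! ### The discriminant of the integral group ring -/

section GroupAlgebra

variable (G : Type*)

/-- `ℤ[G]` is additively generated by the elements of `G`. -/
theorem integralGroupRing_toAddSubgroup [Group G] : (integralGroupRing G).toAddSubgroup =
    AddSubgroup.closure (Set.range (MonoidAlgebra.basis G ℚ)) := by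
  apply le_antisymm
  · rintro _ ⟨x, rfl⟩
    induction x using MonoidAlgebra.induction_linear with
    | zero => simp
    | add f g hf hg => rw [map_add]; exact add_mem hf hg
    | single g n =>
      have : MonoidAlgebra.mapRingHom G (Int.castRingHom ℚ) (MonoidAlgebra.single g n) =
          n • MonoidAlgebra.basis G ℚ g := by
        simp [MonoidAlgebra.smul_single]
      rw [this]
      exact zsmul_mem (AddSubgroup.subset_closure (Set.mem_range_self g)) n
  · rw [AddSubgroup.closure_le]
    rintro _ ⟨g, rfl⟩
    exact RingHom.mem_range.2 ⟨MonoidAlgebra.single g 1, by simp⟩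

variable [CommGroup G] [Fintype G] [DecidableEq G]

/-- Multiplication by `g ≠ 1` permutes `G` without fixed points. -/
theorem trace_monoidAlgebra_single (g : G) :
    Algebra.trace ℚ (MonoidAlgebra ℚ G) (MonoidAlgebra.single g 1) =
      if g = 1 then (Fintype.card G : ℚ) else 0 := by
  rw [Algebra.trace_eq_matrix_trace (MonoidAlgebra.basis G ℚ), Matrix.trace]
  have : ∀ h : G, (MonoidAlgebra.basis G ℚ).repr (MonoidAlgebra.single (g * h) 1) h =
      if g = 1 then (1 : ℚ) else 0 := by
    intro h
    rw [← MonoidAlgebra.basis_apply, Basis.repr_self, Finsupp.single_apply]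
    simp
  simp [Algebra.leftMulMatrix_eq_repr_mul, MonoidAlgebra.single_mul_single, this]

/-- The discriminant of the group algebra is `± |G| ^ |G|`. -/
theorem abs_discr_monoidAlgebra_basis :
    |Algebra.discr ℚ (MonoidAlgebra.basis G ℚ)| = (Fintype.card G : ℚ) ^ Fintype.card G := by
  have : Algebra.traceMatrix ℚ (MonoidAlgebra.basis G ℚ) =
      (Fintype.card G : ℚ) • (Equiv.inv G).toPEquiv.toMatrix := by
    ext g h
    simp only [Algebra.traceMatrix_apply, Algebra.traceForm_apply, MonoidAlgebra.basis_apply,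
      MonoidAlgebra.single_mul_single, one_mul, trace_monoidAlgebra_single, Matrix.smul_apply,
      PEquiv.toMatrix_apply, Equiv.toPEquiv_apply, smul_eq_mul]
    simp [mul_eq_one_iff_inv_eq]
  rw [Algebra.discr_def, this, Matrix.det_smul, Matrix.det_permutation, abs_mul]
  rcases Int.units_eq_one_or (Equiv.Perm.sign (Equiv.inv G)) with h | h <;> simp [h]

end GroupAlgebra

/-! ### Lattice indices and integral bases of products -/

/-- The square of the index of nested lattices is the quotient of their discriminants. -/
theorem relIndex_sq_mul_discr {A ι : Type*} [CommRing A] [Algebra ℚ A] [Fintype ι] [DecidableEq ι]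
    {L₁ L₂ : AddSubgroup A} (H : L₁ ≤ L₂) (b₁ b₂ : Basis ι ℚ A)
    (h₁ : L₁ = .closure (Set.range b₁)) (h₂ : L₂ = .closure (Set.range b₂)) :
    (L₁.relIndex L₂ : ℚ) ^ 2 * |Algebra.discr ℚ b₂| = |Algebra.discr ℚ b₁| := by
  rw [AddSubgroup.relIndex_eq_abs_det L₁ L₂ H b₁ b₂ h₁ h₂, ← abs_pow, ← abs_mul, Basis.det_apply,
    ← Algebra.discr_of_matrix_vecMul, Basis.toMatrix_map_vecMul]

/-- The integral bases of the factors generate the integral closure of a product of number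
fields. -/
theorem closure_pi_integralBasis {ι : Type*} [Fintype ι] [DecidableEq ι] (K : ι → Type*)
    [∀ i, Field (K i)] [∀ i, NumberField (K i)] :
    (integralClosure ℤ (∀ i, K i)).toSubring.toAddSubgroup =
      AddSubgroup.closure (Set.range (Pi.basis fun i => NumberField.integralBasis (K i))) := by
  apply le_antisymm
  · intro x hx
    have hx' : ∀ i, IsIntegral ℤ (x i) := isIntegral_pi_iff.1 hx
    rw [← Finset.univ_sum_single x]
    refine sum_mem fun i _ => ?_
    have hi : x i ∈ Submodule.span ℤ (Set.range (NumberField.integralBasis (K i))) :=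
      (NumberField.mem_span_integralBasis (K i)).2 ⟨⟨x i, hx' i⟩, rfl⟩
    rw [← Submodule.mem_toAddSubgroup, Submodule.span_int_eq_addSubgroupClosure] at hi
    generalize x i = y at hi
    induction hi using AddSubgroup.closure_induction with
    | mem y hy =>
      obtain ⟨k, rfl⟩ := hy
      exact AddSubgroup.subset_closure ⟨⟨i, k⟩, by simp [Pi.basis_apply]⟩
    | zero => simp
    | add y z _ _ hy hz => rw [Pi.single_add]; exact add_mem hy hz
    | neg y _ hy => rw [Pi.single_neg]; exact neg_mem hy
  · rw [AddSubgroup.closure_le]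
    rintro _ ⟨⟨i, k⟩, rfl⟩
    refine isIntegral_pi_iff.2 fun j => ?_
    by_cases hij : j = i
    · subst hij
      simpa [Pi.basis_apply] using
        NumberField.RingOfIntegers.isIntegral_coe (NumberField.RingOfIntegers.basis (K j) k)
    · simpa [Pi.basis_apply, hij] using isIntegral_zero

/-! ### Characters and cyclotomic fields -/

/-- `CyclotomicField d ℚ` is a cyclotomic extension for its canonical structure of `ℚ`-algebra. -/
instance isCyclotomicExtension_cyclotomicField_rat (d : ℕ) :
    IsCyclotomicExtension {d} ℚ (CyclotomicField d ℚ) :=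
  CyclotomicField.instIsCyclotomicExtensionSingletonNatSetOfCharZero d ℚ

/-- A cyclotomic field has an embedding acting on roots of unity as a given embedding followed by
a power map of exponent prime to the conductor. -/
theorem exists_algHom_eq_pow {d : ℕ} [NeZero d] {K : Type*} [Field K] [Algebra ℚ K]
    [IsCyclotomicExtension {d} ℚ K] (f : K →ₐ[ℚ] ℂ) {a : ℕ} (ha : a.Coprime d) :
    ∃ σ : K →ₐ[ℚ] ℂ, ∀ x : K, x ^ d = 1 → σ x = f x ^ a := by
  have hζ := IsCyclotomicExtension.zeta_spec d ℚ K
  set z := IsCyclotomicExtension.zeta d ℚ K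
  have hfz : IsPrimitiveRoot (f z ^ a) d :=
    (hζ.map_of_injective (f := f) f.injective).pow_of_coprime a ha
  let E := hζ.embeddingsEquivPrimitiveRoots ℂ
    (Polynomial.cyclotomic.irreducible_rat (NeZero.pos d))
  refine ⟨E.symm ⟨f z ^ a, (mem_primitiveRoots (NeZero.pos d)).2 hfz⟩, fun x hx => ?_⟩
  have hσ : E.symm ⟨f z ^ a, (mem_primitiveRoots (NeZero.pos d)).2 hfz⟩ z = f z ^ a := by
    rw [← hζ.embeddingsEquivPrimitiveRoots_apply_coe ℂ
      (Polynomial.cyclotomic.irreducible_rat (NeZero.pos d))]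
    exact congrArg Subtype.val (E.apply_symm_apply _)
  obtain ⟨i, -, rfl⟩ := hζ.eq_pow_of_pow_eq_one hx
  rw [map_pow, hσ, map_pow, ← pow_mul, ← pow_mul, mul_comm]

section Characters

variable {G : Type*} [CommGroup G]

/-- The linear extension of a character to the rational group algebra. -/
noncomputable def charLift (χ : G →* ℂˣ) : MonoidAlgebra ℚ G →ₐ[ℚ] ℂ :=
  MonoidAlgebra.lift ℚ ℂ G ((Units.coeHom ℂ).comp χ)

@[simp]
theorem charLift_single (χ : G →* ℂˣ) (g : G) (q : ℚ) :
    charLift χ (MonoidAlgebra.single g q) = q • (χ g : ℂ) := by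
  simp [charLift]

/-- A character whose `d`-th power is trivial factors through the `d`-th cyclotomic field. -/
theorem exists_algHom_cyclotomicField {d : ℕ} [NeZero d] {χ : G →* ℂˣ}
    (hχ : ∀ g, χ g ^ d = 1) :
    ∃ (f : CyclotomicField d ℚ →ₐ[ℚ] ℂ) (ψ : MonoidAlgebra ℚ G →ₐ[ℚ] CyclotomicField d ℚ),
      ∀ x, f (ψ x) = charLift χ x := by
  obtain ⟨f⟩ : Nonempty (CyclotomicField d ℚ →ₐ[ℚ] ℂ) :=
    ⟨IsAlgClosed.lift⟩
  have hf : ∀ x, charLift χ x ∈ f.range := by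
    intro x
    induction x using MonoidAlgebra.induction_linear with
    | zero => rw [map_zero]; exact zero_mem _
    | add x y hx hy => rw [map_add]; exact add_mem hx hy
    | single g q =>
      rw [charLift_single]
      refine f.range.smul_mem ?_ q
      have h1 : (χ g : ℂ) ^ d = 1 := by
        rw [← Units.val_pow_eq_pow_val, hχ, Units.val_one]
      obtain ⟨i, -, hi⟩ := ((IsCyclotomicExtension.zeta_spec d ℚ
        (CyclotomicField d ℚ)).map_of_injective (f := f) f.injective).eq_pow_of_pow_eq_one h1
      rw [← hi, ← map_pow]
      exact f.mem_range_self _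
  refine ⟨f, (AlgEquiv.ofInjective f f.injective).symm.toAlgHom.comp
    ((charLift χ).codRestrict f.range hf), fun x => ?_⟩
  have := (AlgEquiv.ofInjective f f.injective).apply_symm_apply
    ((charLift χ).codRestrict f.range hf x)
  exact congrArg Subtype.val this

variable [Finite G]

/-- The vanishing of a character on a rational element only depends on the cyclic group generated
by the character. -/
theorem charLift_eq_zero_of_zpowers_eq {χ χ' : G →* ℂˣ}
    (h : Subgroup.zpowers χ = Subgroup.zpowers χ') {x : MonoidAlgebra ℚ G}
    (hx : charLift χ x = 0) : charLift χ' x = 0 := by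
  have : NeZero (Monoid.exponent G) := ⟨Monoid.exponent_ne_zero_of_finite⟩
  have hfin : IsOfFinOrder χ := isOfFinOrder_of_finite χ
  have : NeZero (orderOf χ) := ⟨hfin.orderOf_pos.ne'⟩
  obtain ⟨a, hχ'⟩ : χ' ∈ Submonoid.powers χ := by
    rw [hfin.mem_powers_iff_mem_zpowers, h]
    exact Subgroup.mem_zpowers χ'
  have hval : ∀ g, χ' g = χ g ^ a := fun g => (DFunLike.congr_fun hχ' g).symm
  have ha : a.Coprime (orderOf χ) := by
    have h1 : orderOf χ' = orderOf χ := by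
      rw [← Nat.card_zpowers, ← h, Nat.card_zpowers]
    rw [← hχ', hfin.orderOf_pow, Nat.div_eq_self] at h1
    exact Nat.coprime_comm.1 (h1.resolve_left hfin.orderOf_pos.ne')
  have hord : ∀ g, χ g ^ orderOf χ = 1 := DFunLike.congr_fun (pow_orderOf_eq_one χ)
  obtain ⟨f, ψ, hψ⟩ := exists_algHom_cyclotomicField hord
  obtain ⟨σ, hσ⟩ := exists_algHom_eq_pow f ha
  -- `χ` and `χ'` are two embeddings `f`, `σ` of the same `ψ`, so each vanishes at `x` exactly when
  -- `ψ x = 0`.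
  have hcomp : σ.comp ψ = charLift χ' := by
    refine MonoidAlgebra.algHom_ext (fun g => ?_) (Subsingleton.elim _ _)
    rw [AlgHom.comp_apply, hσ, hψ]
    · simp [hval]
    · refine (map_eq_one_iff f f.injective).1 ?_
      rw [map_pow, hψ, charLift_single, one_smul, ← Units.val_pow_eq_pow_val, hord, Units.val_one]
  have h0 : ψ x = 0 := (map_eq_zero_iff f f.injective).1 (by rw [hψ, hx])
  rw [← hcomp, AlgHom.comp_apply, h0, map_zero]

/-- Characters separate the elements of the rational group algebra. -/
theorem eq_zero_of_forall_charLift_eq_zero {x : MonoidAlgebra ℚ G}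
    (hx : ∀ χ : G →* ℂˣ, charLift χ x = 0) : x = 0 := by
  have : Fintype G := Fintype.ofFinite G
  have : NeZero (Monoid.exponent G) := ⟨Monoid.exponent_ne_zero_of_finite⟩
  -- Evaluations at elements of `G` are distinct characters of the dual group, hence linearly
  -- independent by Dedekind.
  let ev : G → ((G →* ℂˣ) →* ℂ) := fun g =>
    (Units.coeHom ℂ).comp (MonoidHom.eval g)
  have hev : Function.Injective ev := fun g g' h =>
    (CommGroup.forall_apply_eq_apply_iff (M := ℂ) G).1 fun χ =>
      Units.ext (DFunLike.congr_fun h χ)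
  have hli := (linearIndependent_monoidHom (G →* ℂˣ) ℂ).comp ev hev
  rw [Fintype.linearIndependent_iff] at hli
  have h0 := hli (fun g => (x.coeff g : ℂ)) (by
    ext χ
    have h := hx χ
    rw [charLift, MonoidAlgebra.lift_apply, Finsupp.sum_fintype _ _ (by simp)] at h
    simpa [ev, Algebra.smul_def] using h)
  ext g
  exact_mod_cast h0 g

end Characters

/-- Every element of a finite group generates exactly one cyclic subgroup. -/
theorem sum_totient_card_cyclic (G : Type*) [Group G] [Finite G]
    [Fintype {H : Subgroup G // IsCyclic H}] :
    ∑ H : {H : Subgroup G // IsCyclic H}, Nat.totient (Nat.card H.1) = Nat.card G := by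
  classical
  have : Fintype G := Fintype.ofFinite G
  -- The fibre over `H` is its set of generators.
  let F : G → {H : Subgroup G // IsCyclic H} := fun g => ⟨Subgroup.zpowers g, inferInstance⟩
  rw [Nat.card_eq_fintype_card, ← Finset.card_univ,
    Finset.card_eq_sum_card_fiberwise (f := F) (t := Finset.univ) (by simp)]
  refine Finset.sum_congr rfl fun H _ => ?_
  have : IsCyclic H.1 := H.2
  have hc := IsCyclic.card_orderOf_eq_totient (α := H.1) (dvd_refl _)
  rw [← Nat.card_eq_fintype_card] at hc
  rw [← hc]
  refine Finset.card_bij (fun g _ => (g : G)) (fun g hg => ?_) (fun _ _ _ _ h => Subtype.ext h) ?_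
  · simp only [Finset.mem_filter, Finset.mem_univ, true_and] at hg ⊢
    refine Subtype.ext (Subgroup.eq_of_le_of_card_ge (by simp [F]) ?_)
    rw [Nat.card_zpowers, Subgroup.orderOf_coe, hg]
  · intro g hg
    simp only [Finset.mem_filter, Finset.mem_univ, true_and] at hg
    have hg' : Subgroup.zpowers g = H.1 := congrArg Subtype.val hg
    refine ⟨⟨g, hg' ▸ Subgroup.mem_zpowers g⟩, ?_, rfl⟩
    simp only [Finset.mem_filter, Finset.mem_univ, true_and]
    rw [Subgroup.orderOf_mk, ← hg', Nat.card_zpowers]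

/-- The rational group algebra of a finite abelian group is a product of cyclotomic fields, one
for each cyclic subgroup. -/
theorem nonempty_algEquiv_pi_cyclotomicField (G : Type*) [CommGroup G] [Finite G] :
    Nonempty (MonoidAlgebra ℚ G ≃ₐ[ℚ]
      ∀ H : {H : Subgroup G // IsCyclic H}, CyclotomicField (Nat.card H.1) ℚ) := by
  have : Fintype {H : Subgroup G // IsCyclic H} := Fintype.ofFinite _
  have : NeZero (Monoid.exponent G) := ⟨Monoid.exponent_ne_zero_of_finite⟩
  -- A non-canonical isomorphism of the dual with `G` matches their cyclic subgroups.
  obtain ⟨e⟩ := CommGroup.monoidHom_mulEquiv_of_hasEnoughRootsOfUnity G ℂ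
  have hgen : ∀ H : {H : Subgroup G // IsCyclic H}, ∃ g : G, Subgroup.zpowers g = H.1 := fun H =>
    H.1.isCyclic_iff_exists_zpowers_eq_top.1 H.2
  choose gen hgen using hgen
  have hψ : ∀ H : {H : Subgroup G // IsCyclic H}, ∃ (f : CyclotomicField (Nat.card H.1) ℚ →ₐ[ℚ] ℂ)
      (ψ : MonoidAlgebra ℚ G →ₐ[ℚ] CyclotomicField (Nat.card H.1) ℚ),
      ∀ x, f (ψ x) = charLift (e.symm (gen H)) x := fun H => by
    refine exists_algHom_cyclotomicField fun g => ?_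
    have h : orderOf (e.symm (gen H)) = Nat.card H.1 := by
      rw [MulEquiv.orderOf_eq, ← Nat.card_zpowers, hgen]
    rw [← h]
    exact DFunLike.congr_fun (pow_orderOf_eq_one (e.symm (gen H))) g
  choose f ψ hψ using hψ
  let Ψ : MonoidAlgebra ℚ G →ₐ[ℚ]
      ∀ H : {H : Subgroup G // IsCyclic H}, CyclotomicField (Nat.card H.1) ℚ := AlgHom.pi ψ
  have hinj : Function.Injective Ψ := by
    rw [injective_iff_map_eq_zero]
    refine fun x hx => eq_zero_of_forall_charLift_eq_zero fun χ => ?_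
    let H : {H : Subgroup G // IsCyclic H} := ⟨Subgroup.zpowers (e χ), inferInstance⟩
    refine charLift_eq_zero_of_zpowers_eq (χ := e.symm (gen H)) ?_ ?_
    · have := congrArg (Subgroup.map e.symm.toMonoidHom) (hgen H)
      simpa [H, MonoidHom.map_zpowers] using this
    · rw [← hψ, show ψ H x = 0 from congrFun hx H, map_zero]
  -- Equality of dimensions upgrades injectivity to bijectivity.
  have hrank : finrank ℚ (MonoidAlgebra ℚ G) = finrank ℚ
      (∀ H : {H : Subgroup G // IsCyclic H}, CyclotomicField (Nat.card H.1) ℚ) := by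
    have : Fintype G := Fintype.ofFinite G
    rw [finrank_pi_fintype, finrank_eq_card_basis (MonoidAlgebra.basis G ℚ),
      ← Nat.card_eq_fintype_card, ← sum_totient_card_cyclic G]
    exact Finset.sum_congr rfl fun H _ => (IsCyclotomicExtension.finrank _
      (Polynomial.cyclotomic.irreducible_rat Nat.card_pos)).symm
  have : FiniteDimensional ℚ (MonoidAlgebra ℚ G) :=
    Module.Finite.of_basis (MonoidAlgebra.basis G ℚ)
  exact ⟨AlgEquiv.ofBijective Ψ ⟨hinj,
    (LinearMap.injective_iff_surjective_of_finrank_eq_finrank (f := Ψ.toLinearMap) hrank).1 hinj⟩⟩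

/-! ### The maximal order and the index formula -/

/-- The product over all cyclic subgroups of a function of their order. -/
theorem prod_cyclic_eq_prod_divisors (G : Type*) [Group G] [Finite G]
    [Fintype {H : Subgroup G // IsCyclic H}] {M : Type*} [CommMonoid M] (F : ℕ → M) :
    ∏ H : {H : Subgroup G // IsCyclic H}, F (Nat.card H.1) =
      ∏ d ∈ (Monoid.exponent G).divisors, F d ^ numCyclicSubgroups G d := by
  classical
  have hmem : ∀ H ∈ (Finset.univ : Finset {H : Subgroup G // IsCyclic H}),
      Nat.card H.1 ∈ (Monoid.exponent G).divisors := fun H _ => by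
    have := H.2
    rw [Nat.mem_divisors, ← IsCyclic.exponent_eq_card]
    exact ⟨Monoid.exponent_submonoid_dvd H.1.toSubmonoid, Monoid.exponent_ne_zero_of_finite⟩
  rw [← Finset.prod_fiberwise_of_maps_to hmem]
  refine Finset.prod_congr rfl fun d _ => ?_
  rw [Finset.prod_congr rfl fun H hH => by rw [(Finset.mem_filter.1 hH).2], Finset.prod_const]
  congr 1
  rw [numCyclicSubgroups, ← Fintype.card_subtype, ← Nat.card_eq_fintype_card]
  exact Nat.card_congr (Equiv.subtypeSubtypeEquivSubtypeInter
    (fun H : Subgroup G => IsCyclic H) fun H => Nat.card H = d)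

theorem abs_discr_cyclotomicField (d : ℕ) [NeZero d] :
    |(NumberField.discr (CyclotomicField d ℚ) : ℝ)| =
      (d : ℝ) ^ d.totient / ∏ p ∈ d.primeFactors, (p : ℝ) ^ (d.totient / (p - 1)) := by
  have h := IsCyclotomicExtension.Rat.natAbs_discr d (CyclotomicField d ℚ)
  rw [← Int.cast_abs, Int.abs_eq_natAbs, Int.cast_natCast, h,
    Nat.cast_div (Nat.prod_primeFactors_pow_totient_ediv_dvd (NeZero.pos _))]
  · push_cast
    rfl
  · rw [Nat.cast_ne_zero, Finset.prod_ne_zero_iff]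
    exact fun p hp => pow_ne_zero _ (Nat.prime_of_mem_primeFactors hp).ne_zero

/-- The integral closure of `ℤ` in the rational group algebra is additively generated by a basis of
known discriminant. -/
theorem exists_basis_integralClosure_monoidAlgebra (G : Type*) [CommGroup G] [Fintype G]
    [DecidableEq G] [Fintype {H : Subgroup G // IsCyclic H}] :
    ∃ b : Basis G ℚ (MonoidAlgebra ℚ G),
      (integralClosure ℤ (MonoidAlgebra ℚ G)).toSubring.toAddSubgroup =
        AddSubgroup.closure (Set.range b) ∧
      Algebra.discr ℚ b = ∏ H : {H : Subgroup G // IsCyclic H},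
        (NumberField.discr (CyclotomicField (Nat.card H.1) ℚ) : ℚ) := by
  classical
  obtain ⟨Φ⟩ := nonempty_algEquiv_pi_cyclotomicField G
  let K := fun H : {H : Subgroup G // IsCyclic H} => CyclotomicField (Nat.card H.1) ℚ
  let b₀ := Pi.basis fun H => NumberField.integralBasis (K H)
  let b₁ : Basis _ ℚ (MonoidAlgebra ℚ G) := b₀.map Φ.symm.toLinearEquiv
  -- Comparing discriminants requires both bases to be indexed by `G`.
  let e := b₁.indexEquiv (MonoidAlgebra.basis G ℚ)
  have hb₁ : ⇑b₁ = Φ.symm ∘ b₀ := rfl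
  refine ⟨b₁.reindex e, ?_, ?_⟩
  · have h₀ := congrArg (AddSubgroup.map Φ.symm.toRingEquiv.toAddMonoidHom)
      (closure_pi_integralBasis K)
    rw [AddMonoidHom.map_closure, ← Set.range_comp] at h₀
    rw [Basis.range_reindex, hb₁]
    refine Eq.trans ?_ h₀
    ext x
    constructor
    · intro hx
      exact ⟨Φ x, IsIntegral.map (Φ.toAlgHom.restrictScalars ℤ) hx, Φ.symm_apply_apply x⟩
    · rintro ⟨y, hy, rfl⟩
      exact IsIntegral.map (Φ.symm.toAlgHom.restrictScalars ℤ) hy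
  · rw [Basis.coe_reindex, Algebra.discr_reindex, hb₁, ← Algebra.discr_eq_discr_of_algEquiv,
      Algebra.discr_pi_basis]
    exact Finset.prod_congr rfl fun H _ => (NumberField.coe_discr (K H)).symm

theorem integralGroupRing_le_integralClosure (G : Type*) [CommGroup G] [Finite G] :
    integralGroupRing G ≤ (integralClosure ℤ (MonoidAlgebra ℚ G)).toSubring :=
  (isZOrder_of_eq_closure_basis _ (integralGroupRing_toAddSubgroup G)).le_integralClosure

/- In the exponent `φ(d) / (p - 1)` both operations on natural numbers are exact, since `p` is a
prime divisor of `d`. -/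
theorem mainTheorem12 (G : Type*) [CommGroup G] [Finite G] :
    (∃! M : Subring (MonoidAlgebra ℚ G), IsMaximalZOrder M) ∧
    ∀ M : Subring (MonoidAlgebra ℚ G), IsMaximalZOrder M →
      integralGroupRing G ≤ M ∧
      ((integralGroupRing G).toAddSubgroup.relIndex M.toAddSubgroup : ℝ) =
        Real.sqrt ((Nat.card G : ℝ) ^ Nat.card G *
          ∏ d ∈ (Monoid.exponent G).divisors,
            (((d : ℝ) ^ Nat.totient d)⁻¹ *
              ∏ p ∈ d.primeFactors, (p : ℝ) ^ (Nat.totient d / (p - 1))) ^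
                numCyclicSubgroups G d) := by
  classical
  have : Fintype G := Fintype.ofFinite G
  have : Fintype {H : Subgroup G // IsCyclic H} := Fintype.ofFinite _
  obtain ⟨b, hb, hdiscr⟩ := exists_basis_integralClosure_monoidAlgebra G
  have hmax {M : Subring (MonoidAlgebra ℚ G)} :=
    isMaximalZOrder_iff_eq_integralClosure (isZOrder_of_eq_closure_basis b hb) (M := M)
  refine ⟨⟨_, hmax.2 rfl, fun M hM => hmax.1 hM⟩, fun M hM => ?_⟩
  obtain rfl := hmax.1 hM
  have hle := integralGroupRing_le_integralClosure G
  refine ⟨hle, (Real.sqrt_sq (Nat.cast_nonneg _)).symm.trans (congrArg Real.sqrt (Eq.symm ?_))⟩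
  have key := congrArg (Rat.cast : ℚ → ℝ) (relIndex_sq_mul_discr hle _ b
    (integralGroupRing_toAddSubgroup G) hb)
  rw [abs_discr_monoidAlgebra_basis, hdiscr, Finset.abs_prod] at key
  push_cast at key
  -- With the product regrouped over cyclic subgroups, each field's discriminant meets its inverse,
  -- leaving only the squared index.
  rw [Nat.card_eq_fintype_card, ← key, mul_assoc, ← prod_cyclic_eq_prod_divisors G fun d =>
    ((d : ℝ) ^ d.totient)⁻¹ * ∏ p ∈ d.primeFactors, (p : ℝ) ^ (d.totient / (p - 1)),
    ← Finset.prod_mul_distrib, Finset.prod_eq_one, mul_one]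
  · rfl
  · intro H _
    have hne : (NumberField.discr (CyclotomicField (Nat.card H.1) ℚ) : ℝ) ≠ 0 :=
      Int.cast_ne_zero.2 (NumberField.discr_ne_zero _)
    rw [inv_mul_eq_div, ← inv_div, ← abs_discr_cyclotomicField]
    exact mul_inv_cancel₀ (abs_ne_zero.2 hne)
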